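/- Let $n\ge 1$. A \emph{signed graph} $G$ on the vertex set $[n+1]=\{1,\dots,n+1\}$ is a finite multiset of $N$ edges, each of which is a negative edge $(i,j,-)$ with $i<j$ or a positive edge $(i,j,+)$ with $i\le j$ (a loop if $i=j$). Put $\mathrm v(i,j,-)=\mathbf e_i-\mathbf e_j$ and $\mathrm v(i,j,+)=\mathbf e_i+\mathbf e_j$ (so $\mathrm v(i,i,+)=2\mathbf e_i$), and let $M_G$ be the $(n+1)\times N$ matrix whose columns are the vectors $\mathrm v(e)$ for the edges $e$ of $G$, with multiplicity. For $\mathbf a\in\mathbb Z^{n+1}$ the \emph{flow polytope} is $\mathcal F_G(\mathbf a)=\{f\in\mathbb R_{\ge 0}^{N} : M_G f=\mathbf a\}$. For an integer polytope $P\subset\mathbb R^N$ of dimension $d$, the \emph{normalized volume} $\mathrm{vol}(P)$ is $d!$ times the volume of $P$ with respect to the lattice of integer points in its affine span, so that a smallest $d$-dimensional integer simplex in the affine span has volume $1$. Let $K^C_{n+1}$ be the signed graph on $[n+1]$ that has each of the edges $(i,j,+)$, $(i,j,-)$ for $1\le i<j\le n+1$ and each of the loops $(i,i,+)$ for $1\le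 i\le n+1$ exactly once, and let $CRYC_{n+1}=\mathcal F_{K^C_{n+1}}(2,0,\dots,0)$. For $2\le v\le n+1$ and $1\le k\le v-1$ let $S^{(v)}_k$ be the multiset of edges $$S_k^{(v)}=\{(i,v,+),(i,v,+)\mid 1\le i\le k-1\}\cup\{(k,v,+),(k,v,+),(k,v,-)\}\cup\{(i,v,+),(i,v,-)\mid k+1\le i\le v-1\},$$ and let $$\mathcal G=\Big\{G=\Big([n+1],\ \bigcup_{v=2}^{n+1}S^{(v)}_{i_v}\Big)\ \Big|\ i_v\in[v-1]\text{ for each } v\in\{2,\dots,n+1\}\Big\}.$$ Then $$\mathrm{vol}(CRYC_{n+1})=\sum_{G\in\mathcal G}\mathrm{vol}\big(\mathcal F_G(2,0,\dots,0)\big).$$ -/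

import Mathlib

open MeasureTheory
open scoped Nat

/-- The possible edges of a signed graph on `n + 1` vertices. The vertex set `{1, …, n+1}` is
modelled by `Fin (n + 1)`, so that the vertex called `v` in the literature is `v - 1` here.
`neg i j` is the negative edge `(i, j, -)` with `i < j`; `pos i j` is the positive edge
`(i, j, +)` with `i ≤ j`, a loop if `i = j` (loops are always positive). -/
inductive SignedEdge (n : ℕ) : Type
  | neg (i j : Fin (n + 1)) (h : i < j) : SignedEdge n
  | pos (i j : Fin (n + 1)) (h : i ≤ j) : SignedEdge n
  deriving DecidableEq, Fintype

/-- The positive type `C` root of an edge: `e_i - e_j` for `(i, j, -)`, and `e_i + e_j` for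
`(i, j, +)` (hence `2 e_i` for a loop at `i`). -/
def SignedEdge.root {n : ℕ} : SignedEdge n → Fin (n + 1) → ℤ
  | .neg i j _ => Pi.single i 1 - Pi.single j 1
  | .pos i j _ => Pi.single i 1 + Pi.single j 1

/-- A signed graph on `n + 1` vertices, given by its multiset of edges. -/
abbrev SignedGraph (n : ℕ) : Type := Multiset (SignedEdge n)

/-- The matrix `M_G`: its columns are indexed by the edges of `G`, listed with multiplicity,
and the column of an edge is its root. -/
def SignedGraph.matrix {n : ℕ} (G : SignedGraph n) : Matrix (Fin (n + 1)) G.ToType ℝ :=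
  Matrix.of fun v e => (e.1.root v : ℝ)

/-- The flow polytope `F_G(a)`: all nonnegative real flows on the edges of `G` (with
multiplicity) with netflow vector `a`. -/
def SignedGraph.flowPolytope {n : ℕ} (G : SignedGraph n) (a : Fin (n + 1) → ℤ) :
    Set (G.ToType → ℝ) :=
  {f | (∀ e, 0 ≤ f e) ∧ (G.matrix).mulVec f = fun v => (a v : ℝ)}

/-- The lattice of integer points of a linear subspace of `ℝ^ι`. -/
def integerPoints {ι : Type} (V : Submodule ℝ (ι → ℝ)) : Submodule ℤ V where
  carrier := {x | ∀ i, ∃ k : ℤ, (x : ι → ℝ) i = k}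
  add_mem' := by
    intro x y hx hy i
    obtain ⟨k, hk⟩ := hx i
    obtain ⟨l, hl⟩ := hy i
    exact ⟨k + l, by simp [hk, hl]⟩
  zero_mem' := fun _ => ⟨0, by simp⟩
  smul_mem' := by
    intro c x hx i
    obtain ⟨k, hk⟩ := hx i
    exact ⟨c * k, by simp [hk]⟩

open Classical in
/-- The normalized volume of an integer polytope `P` in `ℝ^ι`. Let `V` be the direction of the
affine span of `P` and `d = dim V`. The polytope, translated into `V` by one of its points, is
measured by the Haar measure of `V` that gives volume one to a fundamental domain of the lattice
of integer points of `V`, and the result is multiplied by `d!`, so that the smallest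
`d`-dimensional integer simplices have volume one. (`Measure.addHaar` is some Haar measure of `V`;
its choice cancels in the quotient, and by translation invariance so does the base point.)
The empty set has volume zero. -/
noncomputable def normalizedVolume {ι : Type} [Fintype ι] (P : Set (ι → ℝ)) : ℝ :=
  if h : P.Nonempty then
    (Module.finrank ℝ (vectorSpan ℝ P))! *
      ((Measure.addHaar : Measure (vectorSpan ℝ P)).real
          {x | (x : ι → ℝ) + h.some ∈ P} /
        ZLattice.covolume (integerPoints (vectorSpan ℝ P)) Measure.addHaar)
  else 0

/-- The netflow vector `(2, 0, …, 0)`. -/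
def netflowTwo (n : ℕ) : Fin (n + 1) → ℤ := Pi.single 0 2

/-- The complete signed graph `K^C_{n+1}`: each of the edges `(i, j, -)`, `(i, j, +)` with
`i < j` and each of the loops `(i, i, +)`, exactly once. -/
def completeGraphC (n : ℕ) : SignedGraph n := (Finset.univ : Finset (SignedEdge n)).val

/-- The type `C` Chan-Robbins-Yuen polytope `CRYC_{n+1} = F_{K^C_{n+1}}(2, 0, …, 0)`. -/
def CRYC (n : ℕ) : Set ((completeGraphC n).ToType → ℝ) :=
  (completeGraphC n).flowPolytope (netflowTwo n)

/-- The vertex `i` of the graph, for `i` one of the vertices that precede `v.succ`. -/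
def earlierVertex {n : ℕ} (v : Fin n) (i : Fin (v + 1)) : Fin (n + 1) :=
  ⟨i, lt_of_lt_of_le i.isLt (Nat.succ_le_succ v.isLt.le)⟩

theorem earlierVertex_lt {n : ℕ} (v : Fin n) (i : Fin (v + 1)) :
    earlierVertex v i < v.succ := by
  simp only [Fin.lt_def, earlierVertex, Fin.val_succ]
  exact i.isLt

/-- The edges between the vertex `v.succ` and the earlier vertices in the multiset `S_k`, where
`k` is one of the earlier vertices: `(i, +), (i, +)` for `i < k`, `(k, +), (k, +), (k, -)`, and
`(i, +), (i, -)` for `i > k`. As `v` runs through `Fin n`, `v.succ` runs through all vertices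
but the first. -/
def edgeSetS {n : ℕ} (v : Fin n) (k : Fin (v + 1)) : SignedGraph n :=
  ∑ i : Fin (v + 1),
    let p : SignedEdge n := .pos (earlierVertex v i) v.succ (earlierVertex_lt v i).le
    let m : SignedEdge n := .neg (earlierVertex v i) v.succ (earlierVertex_lt v i)
    if i < k then {p, p} else if i = k then {p, p, m} else {p, m}

/-- The family of the graphs with edge multiset `⋃_v S^{(v)}_{i_v}` (a union of multisets that
have no edge in common), one for each choice of a vertex `i_v` before `v` for each vertex `v`
but the first. -/
def graphFamily (n : ℕ) : Finset (SignedGraph n) :=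
  (Finset.univ : Finset ((v : Fin n) → Fin (v + 1))).image fun i => ∑ v : Fin n, edgeSetS v (i v)

/-! The loop at the first vertex has a root that already accounts for the whole netflow. So the
polytope is a pyramid of lattice height one: its apex is the unit flow on that loop, and its base
consists of the flows that avoid it. Such a pyramid has the same normalized volume as its base
(`volume_pyramid`, `normalizedVolume_CRYC`).

The base is subdivided by means of the relation `e_i + e_v = (e_i - e_v) + 2 e_v`: flow on a
positive edge can be traded for equal amounts on the parallel negative edge and on the loop at `v`.
Conservation at `v` bounds the loop flow by the total flow on the negative edges ending at `v`
(`loop_le_sum_neg`), hence the loop flow lies between the partial sums over `j < k` and over `j ≤ k`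
of these negative flows, for some `k`. Pairing it with all the negative flow from the `j < k` and
with a part of that from `k` turns the loop and the negative edges before `k` into positive edges.
What remains is a flow on the edges of `S_k`.

The trade is a unimodular map (`flowChange`), so each piece has the normalized volume of the
corresponding `F_G`. The pieces cover the base, and two of them meet only where some loop flow
equals a partial sum, which is a null set (`flowRegion_eq_iUnion`, `aedisjoint_flowPiece`).

All volumes are compared in one integral coordinate system on the flows of netflow zero
(`flowParam`). Strictly positive flows guarantee that each polytope affinely spans its whole
solution space. -/

/-! ### Normalized volume in unimodular coordinates -/

/-- A linear coordinate system that maps a lattice onto the standard lattice turns the quotient of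
a Haar measure by the covolume of the lattice into Lebesgue measure. -/
theorem addHaar_div_covolume_eq_volume_image {V κ : Type*} [NormedAddCommGroup V]
    [NormedSpace ℝ V] [FiniteDimensional ℝ V] [MeasurableSpace V] [BorelSpace V] [Fintype κ]
    (μ : Measure V) [μ.IsAddHaarMeasure] (Λ : Submodule ℤ V) (e : V ≃ₗ[ℝ] (κ → ℝ))
    (he : ∀ x, x ∈ Λ ↔ ∀ k, ∃ z : ℤ, e x k = z) (S : Set V) :
    μ.real S / ZLattice.covolume Λ μ = volume.real (e '' S) := by
  classical
  set b : Module.Basis κ ℝ V := Module.Basis.ofEquivFun e with hb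
  have hΛ : Λ = Submodule.span ℤ (Set.range b) := by
    ext x
    rw [he, Module.Basis.mem_span_iff_repr_mem]
    refine forall_congr' fun k => ?_
    simp [hb, eq_comm]
  have hcov : ZLattice.covolume Λ μ = μ.real (ZSpan.fundamentalDomain b) := by
    rw [hΛ]
    exact ZLattice.covolume_eq_measure_fundamentalDomain _ _ (ZSpan.isAddFundamentalDomain b μ)
  have hmeas : ∀ T : Set V, μ T = (μ.map e.toContinuousLinearEquiv) (e '' T) := by
    intro T
    rw [show (μ.map e.toContinuousLinearEquiv)
      = μ.map e.toContinuousLinearEquiv.toHomeomorph.toMeasurableEquiv from rfl,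
      MeasurableEquiv.map_apply]
    congr 1
    exact (Set.preimage_image_eq T e.injective).symm
  have hsmul := Measure.isAddLeftInvariant_eq_smul (μ.map e.toContinuousLinearEquiv)
    (volume : Measure (κ → ℝ))
  set c := Measure.addHaarScalarFactor (μ.map e.toContinuousLinearEquiv)
    (volume : Measure (κ → ℝ)) with hc
  -- By uniqueness of Haar measure `μ` is a multiple of Lebesgue measure; the factor `c` cancels in
  -- the quotient.
  have hreal : ∀ T : Set V, μ.real T = c * volume.real (e '' T) := by
    intro T
    rw [Measure.real, hmeas, hsmul, Measure.real, Measure.smul_apply, ENNReal.smul_def,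
      smul_eq_mul, ENNReal.toReal_mul, ENNReal.coe_toReal]
  have hfund : e '' ZSpan.fundamentalDomain b = Set.univ.pi fun _ => Set.Ico (0 : ℝ) 1 := by
    ext y
    constructor
    · rintro ⟨x, hx, rfl⟩ k -
      simpa [hb] using hx k
    · intro hy
      refine ⟨e.symm y, fun k => ?_, by simp⟩
      simpa [hb] using hy k trivial
  have hone : volume.real (e '' ZSpan.fundamentalDomain b) = 1 := by
    rw [hfund, Measure.real, volume_pi_pi]
    simp
  have hc0 : (c : ℝ) ≠ 0 := by
    have h : c ≠ 0 := by
      rw [hc]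
      exact (Measure.addHaarScalarFactor_pos_of_isAddHaarMeasure _ _).ne'
    exact_mod_cast h
  rw [hcov, hreal S, hreal (ZSpan.fundamentalDomain b), hone, mul_one, mul_div_cancel_left₀ _ hc0]

/-- The normalized volume of a set, computed in a unimodular parametrization of its affine span. -/
theorem normalizedVolume_eq_of_parametrization {ι κ : Type} [Fintype ι] [Fintype κ]
    {P : Set (ι → ℝ)} (ψ : (κ → ℝ) →ₗ[ℝ] (ι → ℝ)) (hψ : Function.Injective ψ)
    (hrange : LinearMap.range ψ = vectorSpan ℝ P)
    (hint : ∀ x, (∀ i, ∃ z : ℤ, ψ x i = z) ↔ ∀ k, ∃ z : ℤ, x k = z)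
    {p q : ι → ℝ} (hq : q ∈ P) (hp : p - q ∈ vectorSpan ℝ P) :
    normalizedVolume P = (Fintype.card κ)! * volume.real {x | ψ x + p ∈ P} := by
  have hne : P.Nonempty := ⟨q, hq⟩
  rw [normalizedVolume, dif_pos hne]
  -- The base point chosen in the definition may be replaced by any `p` of the affine span, in `P`
  -- or not; the difference is a translation by `y`.
  have hp' : hne.some - p ∈ vectorSpan ℝ P := by
    have := (vectorSpan ℝ P).sub_mem (vsub_mem_vectorSpan ℝ hne.some_mem hq) hp
    simpa using this
  generalize hne.some = s at hp' ⊢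
  rw [← hrange] at hp'
  obtain ⟨y, hy⟩ := hp'
  set e := (LinearEquiv.ofInjective ψ hψ).trans (LinearEquiv.ofEq _ _ hrange) with he
  have hψe : ∀ x : vectorSpan ℝ P, ψ (e.symm x) = x := fun x => by
    conv_rhs => rw [← e.apply_symm_apply x]
    rfl
  have hcard : Module.finrank ℝ (vectorSpan ℝ P) = Fintype.card κ := by
    rw [← e.finrank_eq, Module.finrank_fintype_fun_eq_card]
  rw [hcard, addHaar_div_covolume_eq_volume_image Measure.addHaar _ e.symm]
  · congr 1
    have himage : e.symm '' {x | (x : ι → ℝ) + s ∈ P}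
        = (fun x => x + y) ⁻¹' {x | ψ x + p ∈ P} := by
      ext x
      have hs : s = ψ y + p := by rw [hy]; simp
      constructor
      · rintro ⟨z, hz, rfl⟩
        simp only [Set.mem_preimage, Set.mem_ofPred_eq, map_add, hψe, add_assoc] at hz ⊢
        rwa [← hs]
      · intro hx
        refine ⟨e x, ?_, by simp⟩
        simp only [Set.mem_preimage, Set.mem_ofPred_eq, map_add, add_assoc, ← hs] at hx
        exact hx
    rw [himage, Measure.real, measure_preimage_add_right, Measure.real]
  · intro x
    rw [← hint, hψe]
    rfl

/-! ### Flow polytopes with indexed edges -/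

/-- The netflow map of the signed graph whose edges are indexed by `E` and labelled by `lab`. -/
noncomputable def netflow {n : ℕ} {E : Type} [Fintype E] (lab : E → SignedEdge n) :
    (E → ℝ) →ₗ[ℝ] (Fin (n + 1) → ℝ) :=
  Matrix.mulVecLin (Matrix.of fun v e => ((lab e).root v : ℝ))

theorem netflow_apply {n : ℕ} {E : Type} [Fintype E] (lab : E → SignedEdge n) (f : E → ℝ)
    (v : Fin (n + 1)) : netflow lab f v = ∑ e, ((lab e).root v : ℝ) * f e := rfl

theorem netflow_single {n : ℕ} {E : Type} [Fintype E] [DecidableEq E] (lab : E → SignedEdge n)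
    (e : E) (c : ℝ) (v : Fin (n + 1)) :
    netflow lab (Pi.single e c) v = (lab e).root v * c := by
  rw [netflow_apply, Finset.sum_eq_single e]
  · simp
  · intro b _ hb
    simp [hb]
  · simp

/-- A finite type that labels the elements of a multiset is equivalent to the multiset. -/
theorem Multiset.exists_equiv_toType {α E : Type*} [DecidableEq α] [Fintype E] (lab : E → α)
    (G : Multiset α) (hG : G = Finset.univ.val.map lab) :
    ∃ σ : E ≃ G.ToType, ∀ e, (σ e).1 = lab e := by
  classical
  subst hG
  have hcount : ∀ e : E, (Finset.univ : Finset E).val.count e = 1 := fun e =>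
    Multiset.count_eq_one_of_mem Finset.univ.nodup (Finset.mem_univ e)
  let τ : E ≃ (Finset.univ : Finset E).val.ToType :=
    { toFun := fun e => ⟨e, ⟨0, by rw [hcount]; exact one_pos⟩⟩
      invFun := fun x => x.1
      left_inv := fun _ => rfl
      right_inv := fun ⟨e, i⟩ => by
        have hi := i.isLt.trans_eq (hcount e)
        exact congrArg (Sigma.mk e) (Fin.ext (Nat.lt_one_iff.1 hi).symm) }
  exact ⟨τ.trans (Multiset.mapEquiv _ lab), fun e => Multiset.mapEquiv_apply _ lab (τ e)⟩

/-- If a linear system has a strictly positive solution, then the direction of its polyhedron of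
nonnegative solutions is the kernel of the system. -/
theorem vectorSpan_nonneg_solutions_eq_ker {E W : Type*} [Finite E] [AddCommGroup W] [Module ℝ W]
    (A : (E → ℝ) →ₗ[ℝ] W) (a : W) (f : E → ℝ) (hf : ∀ e, 0 < f e) (hA : A f = a) :
    vectorSpan ℝ {x : E → ℝ | (∀ e, 0 ≤ x e) ∧ A x = a} = LinearMap.ker A := by
  have := Fintype.ofFinite E
  apply le_antisymm
  · rw [vectorSpan_def, Submodule.span_le]
    rintro _ ⟨x, hx, y, hy, rfl⟩
    simp [hx.2, hy.2]
  · intro x hx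
    rw [LinearMap.mem_ker] at hx
    obtain ⟨t, ht0, ht⟩ : ∃ t : ℝ, 0 < t ∧ ∀ e, 0 ≤ t * x e + f e := by
      have h : ∀ᶠ t : ℝ in nhds 0, ∀ e, 0 < t * x e + f e := by
        rw [Filter.eventually_all]
        intro e
        have hc : Continuous fun t : ℝ => t * x e + f e := by fun_prop
        exact hc.continuousAt.eventually (lt_mem_nhds (by simpa using hf e))
      obtain ⟨ε, hε, hball⟩ := Metric.eventually_nhds_iff.1 h
      refine ⟨ε / 2, by positivity, fun e => (hball ?_ e).le⟩
      rw [Real.dist_eq, sub_zero, abs_of_pos (by positivity)]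
      linarith
    -- Both `f` and its small perturbation `t • x + f` lie in the polyhedron, and their difference
    -- is a nonzero multiple of `x`.
    have hmem := vsub_mem_vectorSpan ℝ
      (s := {x : E → ℝ | (∀ e, 0 ≤ x e) ∧ A x = a}) (p₁ := t • x + f) (p₂ := f)
      ⟨fun e => by simpa using ht e, by simp [hx, hA]⟩ ⟨fun e => (hf e).le, hA⟩
    have := Submodule.smul_mem _ t⁻¹ hmem
    simpa [smul_smul, ht0.ne'] using this

/-- The normalized volume of a flow polytope with a strictly positive flow, computed in a
unimodular parametrization of the space of flows of netflow zero. -/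
theorem normalizedVolume_flowPolytope_eq {n : ℕ} {E κ : Type} [Fintype E] [Fintype κ]
    (lab : E → SignedEdge n) (G : SignedGraph n) (hG : G = Finset.univ.val.map lab)
    (a : Fin (n + 1) → ℤ) (f : E → ℝ) (hf : ∀ e, 0 < f e)
    (hfa : netflow lab f = fun v => (a v : ℝ))
    (ψ : (κ → ℝ) →ₗ[ℝ] (E → ℝ)) (hψ : Function.Injective ψ)
    (hrange : LinearMap.range ψ = LinearMap.ker (netflow lab))
    (hint : ∀ x, (∀ i, ∃ z : ℤ, ψ x i = z) ↔ ∀ k, ∃ z : ℤ, x k = z)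
    (p : E → ℝ) (hp : netflow lab p = fun v => (a v : ℝ)) :
    normalizedVolume (G.flowPolytope a)
      = (Fintype.card κ)! * volume.real {x | ∀ e, 0 ≤ ψ x e + p e} := by
  obtain ⟨σ, hσ⟩ := Multiset.exists_equiv_toType lab G hG
  have hflow : ∀ g : G.ToType → ℝ, G.matrix.mulVecLin g = netflow lab (g ∘ σ) := by
    intro g
    ext v
    rw [netflow_apply]
    refine (Fintype.sum_equiv σ _ _ fun e => ?_).symm
    simp [SignedGraph.matrix, hσ]
  have hdef : G.flowPolytope a
      = {x | (∀ e, 0 ≤ x e) ∧ G.matrix.mulVecLin x = fun v => (a v : ℝ)} := rfl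
  have hspan : vectorSpan ℝ (G.flowPolytope a) = LinearMap.ker G.matrix.mulVecLin := by
    rw [hdef]
    refine vectorSpan_nonneg_solutions_eq_ker _ _ (f ∘ σ.symm) (fun e => hf _) ?_
    rw [hflow, Function.comp_assoc, σ.symm_comp_self, Function.comp_id, hfa]
  let R : (E → ℝ) ≃ₗ[ℝ] (G.ToType → ℝ) := LinearEquiv.funCongrLeft ℝ ℝ σ.symm
  have hR : ∀ g, R g = g ∘ σ.symm := fun _ => rfl
  have hflowR : ∀ g, G.matrix.mulVecLin (R g) = netflow lab g := fun g => by
    rw [hflow, hR, Function.comp_assoc, σ.symm_comp_self, Function.comp_id]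
  rw [normalizedVolume_eq_of_parametrization (P := G.flowPolytope a) (R.toLinearMap ∘ₗ ψ)
    (R.injective.comp hψ) (p := R p) (q := R f)]
  · congr 2
    ext x
    have hx : netflow lab (ψ x) = 0 := by
      rw [← LinearMap.mem_ker, ← hrange]
      exact ⟨x, rfl⟩
    simp only [hdef, LinearMap.comp_apply, LinearEquiv.coe_coe, Set.mem_ofPred_eq, ← map_add,
      hflowR]
    rw [map_add (netflow lab), hx, hp, zero_add, and_iff_left rfl]
    exact ⟨fun h e => by simpa [hR] using h (σ e), fun h e => by simpa [hR] using h (σ.symm e)⟩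
  · rw [hspan, LinearMap.range_comp, hrange]
    ext g
    constructor
    · rintro ⟨x, hx, rfl⟩
      simpa [hflowR] using hx
    · intro hg
      refine ⟨R.symm g, ?_, by simp⟩
      rw [SetLike.mem_coe, LinearMap.mem_ker, ← hflowR, R.apply_symm_apply]
      exact hg
  · intro x
    rw [← hint]
    exact ⟨fun h e => by simpa [hR] using h (σ e), fun h e => by simpa [hR] using h (σ.symm e)⟩
  · rw [hdef]
    exact ⟨fun e => (hf _).le, by rw [hflowR, hfa]⟩
  · rw [hspan, LinearMap.mem_ker, map_sub, hflowR, hflowR, hp, hfa, sub_self]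

/-! ### Common index set for the edges of the complete graph and of the family -/

/-- Indices for the edges of the complete signed graph other than the loop at the first vertex.
For a vertex `v.succ` and a vertex `i` before it, `⟨v, .inl i⟩` stands for the positive edge,
`⟨v, .inr (.inl i)⟩` for the negative edge, and `⟨v, .inr (.inr ())⟩` for the loop at `v.succ`. -/
abbrev EdgeIndex (n : ℕ) : Type := (v : Fin n) × (Fin (v + 1) ⊕ Fin (v + 1) ⊕ Unit)

namespace EdgeIndex

variable {n : ℕ}

/-- The positive edge between `v.succ` and the earlier vertex `i`. -/
def posEdge (v : Fin n) (i : Fin (v + 1)) : SignedEdge n :=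
  .pos (earlierVertex v i) v.succ (earlierVertex_lt v i).le

/-- The negative edge between `v.succ` and the earlier vertex `i`. -/
def negEdge (v : Fin n) (i : Fin (v + 1)) : SignedEdge n :=
  .neg (earlierVertex v i) v.succ (earlierVertex_lt v i)

/-- The edges of the complete signed graph other than the loop at the first vertex. -/
def label : EdgeIndex n → SignedEdge n
  | ⟨v, .inl i⟩ => posEdge v i
  | ⟨v, .inr (.inl i)⟩ => negEdge v i
  | ⟨v, .inr (.inr _)⟩ => .pos v.succ v.succ le_rfl

/-- All edges of the complete signed graph. -/
def completeLabel : Option (EdgeIndex n) → SignedEdge n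
  | none => .pos 0 0 le_rfl
  | some e => label e

/-- The edges of the graph of the family that belongs to the choice `k`. -/
def familyLabel (k : (v : Fin n) → Fin (v + 1)) : EdgeIndex n → SignedEdge n
  | ⟨v, .inl i⟩ => posEdge v i
  | ⟨v, .inr (.inl i)⟩ => if i < k v then posEdge v i else negEdge v i
  | ⟨v, .inr (.inr _)⟩ => posEdge v (k v)

theorem sum_edgeIndex {M : Type*} [AddCommMonoid M] (F : EdgeIndex n → M) :
    ∑ e, F e = ∑ v : Fin n, (∑ i, F ⟨v, .inl i⟩ +
      (∑ i, F ⟨v, .inr (.inl i)⟩ + F ⟨v, .inr (.inr ())⟩)) := by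
  rw [Fintype.sum_sigma]
  refine Finset.sum_congr rfl fun v _ => ?_
  rw [Fintype.sum_sum_type, Fintype.sum_sum_type]
  simp

theorem completeLabel_bijective : Function.Bijective (completeLabel (n := n)) := by
  have hsucc : ∀ j : Fin (n + 1), j ≠ 0 → ∃ v : Fin n, j = v.succ := fun j hj =>
    ⟨j.pred hj, by simp⟩
  have hearlier : ∀ (v : Fin n) (i : Fin (n + 1)), i < v.succ →
      ∃ i' : Fin (v + 1), earlierVertex v i' = i := fun v i hi =>
    ⟨⟨i, by simpa [Fin.lt_def] using hi⟩, rfl⟩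
  have hinj : ∀ (v : Fin n) (i j : Fin (v + 1)), earlierVertex v i = earlierVertex v j → i = j :=
    fun v i j h => by simpa [earlierVertex, Fin.ext_iff] using h
  have hne : ∀ (v : Fin n) (i : Fin (v + 1)), earlierVertex v i ≠ v.succ :=
    fun v i => (earlierVertex_lt v i).ne
  constructor
  · rintro (_ | ⟨v, i | i | _⟩) (_ | ⟨w, j | j | _⟩) h
    all_goals
      simp only [completeLabel, label, posEdge, negEdge, SignedEdge.pos.injEq,
        SignedEdge.neg.injEq, reduceCtorEq, Fin.succ_inj] at h
    · rfl
    · exact absurd h.2.symm (Fin.succ_ne_zero _)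
    · exact absurd h.2.symm (Fin.succ_ne_zero _)
    · exact absurd h.2 (Fin.succ_ne_zero _)
    · obtain ⟨h, rfl⟩ := h
      rw [hinj _ _ _ h]
    · obtain ⟨h, rfl⟩ := h
      exact absurd h (hne _ _)
    · obtain ⟨h, rfl⟩ := h
      rw [hinj _ _ _ h]
    · exact absurd h.2 (Fin.succ_ne_zero _)
    · obtain ⟨h, rfl⟩ := h
      exact absurd h.symm (hne _ _)
    · obtain ⟨rfl, -⟩ := h
      rfl
  · rintro (⟨i, j, h⟩ | ⟨i, j, h⟩)
    · obtain ⟨v, rfl⟩ := hsucc j (Fin.ne_zero_of_lt h)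
      obtain ⟨i, rfl⟩ := hearlier v i h
      exact ⟨some ⟨v, .inr (.inl i)⟩, rfl⟩
    · by_cases hj : j = 0
      · subst hj
        obtain rfl : i = 0 := Fin.le_zero_iff.1 h
        exact ⟨none, rfl⟩
      · obtain ⟨v, rfl⟩ := hsucc j hj
        rcases h.lt_or_eq with h | rfl
        · obtain ⟨i, rfl⟩ := hearlier v i h
          exact ⟨some ⟨v, .inl i⟩, rfl⟩
        · exact ⟨some ⟨v, .inr (.inr ())⟩, rfl⟩

theorem completeGraphC_eq_map : completeGraphC n = Finset.univ.val.map completeLabel := by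
  rw [completeGraphC, ← Finset.map_univ_equiv (Equiv.ofBijective _ completeLabel_bijective)]
  rfl

theorem sum_edgeSetS_eq_map (k : (v : Fin n) → Fin (v + 1)) :
    ∑ v, edgeSetS v (k v) = Finset.univ.val.map (familyLabel k) := by
  have h : Finset.univ.val.map (familyLabel k)
      = ∑ e, ({familyLabel k e} : Multiset (SignedEdge n)) := by
    rw [← Finset.sum_multiset_singleton (Finset.univ : Finset (EdgeIndex n))]
    exact (map_sum (Multiset.mapAddMonoidHom (familyLabel k)) _ _).trans (by simp)
  rw [h, sum_edgeIndex]
  refine Finset.sum_congr rfl fun v _ => ?_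
  have hk : ({posEdge v (k v)} : Multiset (SignedEdge n))
      = ∑ i, if i = k v then {posEdge v i} else 0 := by simp
  simp only [familyLabel]
  rw [hk, ← Finset.sum_add_distrib, ← Finset.sum_add_distrib, edgeSetS]
  refine Finset.sum_congr rfl fun i _ => ?_
  simp only [← posEdge.eq_1, ← negEdge.eq_1]
  rcases lt_trichotomy i (k v) with h | h | h
  · simp only [h, h.ne, if_true, if_false, add_zero]
    rfl
  · simp only [h, lt_irrefl, if_true, if_false]
    rw [add_comm {negEdge v (k v)}]
    rfl
  · simp only [h.not_gt, h.ne', if_false, add_zero]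
    rfl

/-- `graphFamily` is an image and would merge equal graphs. The choice can be read off a graph: `k
v` is the least `i` whose negative edge to `v.succ` is present. -/
theorem familySum_injective :
    Function.Injective fun k : (v : Fin n) → Fin (v + 1) => ∑ v, edgeSetS v (k v) := by
  intro k l h
  simp only [sum_edgeSetS_eq_map] at h
  have key : ∀ (k l : (v : Fin n) → Fin (v + 1)),
      Finset.univ.val.map (familyLabel k) = Finset.univ.val.map (familyLabel l) →
      ∀ v, l v ≤ k v := by
    intro k l h v
    have hmem : negEdge v (k v) ∈ Finset.univ.val.map (familyLabel l) := by
      rw [← h, Multiset.mem_map]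
      exact ⟨⟨v, .inr (.inl (k v))⟩, Finset.mem_univ _, by simp [familyLabel]⟩
    rw [Multiset.mem_map] at hmem
    obtain ⟨⟨w, i | i | _⟩, -, he⟩ := hmem
    · simp [familyLabel, posEdge, negEdge] at he
    · simp only [familyLabel] at he
      split_ifs at he with hi
      · simp [posEdge, negEdge] at he
      · simp only [negEdge, SignedEdge.neg.injEq, Fin.succ_inj] at he
        obtain ⟨hiv, rfl⟩ := he
        have : i = k w := by simpa [earlierVertex, Fin.ext_iff] using hiv
        rw [← this]
        exact not_lt.1 hi
    · simp [familyLabel, posEdge, negEdge] at he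
  funext v
  exact le_antisymm (key l k h.symm v) (key k l h v)

theorem root_posEdge (v : Fin n) (i : Fin (v + 1)) :
    (posEdge v i).root = Pi.single (earlierVertex v i) 1 + Pi.single v.succ 1 := rfl

theorem root_negEdge (v : Fin n) (i : Fin (v + 1)) :
    (negEdge v i).root = Pi.single (earlierVertex v i) 1 - Pi.single v.succ 1 := rfl

/-! ### Trading positive edges for negative edges and loops -/

/-- The unimodular change of coordinates from flows on a graph of the family to flows on the
complete signed graph without the loop at the first vertex. -/
noncomputable def flowChange (k : (v : Fin n) → Fin (v + 1)) :
    (EdgeIndex n → ℝ) ≃ₗ[ℝ] (EdgeIndex n → ℝ) where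
  toFun g
    | ⟨v, .inl i⟩ => g ⟨v, .inl i⟩
    | ⟨v, .inr (.inl i)⟩ => g ⟨v, .inr (.inl i)⟩ + if i = k v then g ⟨v, .inr (.inr ())⟩ else 0
    | ⟨v, .inr (.inr _)⟩ => g ⟨v, .inr (.inr ())⟩ + ∑ j ∈ Finset.Iio (k v), g ⟨v, .inr (.inl j)⟩
  invFun f
    | ⟨v, .inl i⟩ => f ⟨v, .inl i⟩
    | ⟨v, .inr (.inl i)⟩ => f ⟨v, .inr (.inl i)⟩ -
        if i = k v then f ⟨v, .inr (.inr ())⟩ - ∑ j ∈ Finset.Iio (k v), f ⟨v, .inr (.inl j)⟩ else 0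
    | ⟨v, .inr (.inr _)⟩ => f ⟨v, .inr (.inr ())⟩ - ∑ j ∈ Finset.Iio (k v), f ⟨v, .inr (.inl j)⟩
  map_add' f g := by
    ext ⟨v, i | i | _⟩
    · simp
    · by_cases h : i = k v <;> simp [h]
      ring
    · simp [Finset.sum_add_distrib]; ring
  map_smul' c f := by
    ext ⟨v, i | i | _⟩
    · simp
    · by_cases h : i = k v <;> simp [h]
      ring
    · simp [← Finset.mul_sum]; ring
  left_inv g := by
    have hsum : ∀ v, (∑ j ∈ Finset.Iio (k v), (g ⟨v, .inr (.inl j)⟩ +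
        if j = k v then g ⟨v, .inr (.inr ())⟩ else 0))
        = ∑ j ∈ Finset.Iio (k v), g ⟨v, .inr (.inl j)⟩ := fun v =>
      Finset.sum_congr rfl fun j hj => by simp [(Finset.mem_Iio.1 hj).ne]
    ext ⟨v, i | i | _⟩
    · simp
    · by_cases h : i = k v <;> simp [h, hsum]
    · simp [hsum]
  right_inv f := by
    have hsum : ∀ v (c : ℝ), (∑ j ∈ Finset.Iio (k v), (f ⟨v, .inr (.inl j)⟩ -
        if j = k v then c else 0))
        = ∑ j ∈ Finset.Iio (k v), f ⟨v, .inr (.inl j)⟩ := fun v c =>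
      Finset.sum_congr rfl fun j hj => by simp [(Finset.mem_Iio.1 hj).ne]
    ext ⟨v, i | i | _⟩
    · simp
    · by_cases h : i = k v <;> simp [h]
    · simp only [hsum]; simp

/-- Each positive edge among the second and third kinds of index is split by `h2` into the parallel
negative edge and the loop at `v.succ`. The edges `i < k v` keep their value on the negative edge
and add it to the loop; the extra edge at `k v` adds to both. -/
theorem netflow_flowChange (k : (v : Fin n) → Fin (v + 1)) (g : EdgeIndex n → ℝ) :
    netflow label (flowChange k g) = netflow (familyLabel k) g := by
  ext u
  rw [netflow_apply, netflow_apply, sum_edgeIndex, sum_edgeIndex]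
  refine Finset.sum_congr rfl fun v _ => ?_
  congr 1
  have h1 : ∑ j ∈ Finset.Iio (k v), g ⟨v, .inr (.inl j)⟩
      = ∑ j, if j < k v then g ⟨v, .inr (.inl j)⟩ else 0 := by
    rw [← Finset.sum_filter]
    congr 1
    ext j
    simp
  have h2 : ∀ i, ((posEdge v i).root u : ℝ)
      = (negEdge v i).root u + (label ⟨v, .inr (.inr ())⟩).root u := by
    intro i
    rw [root_posEdge, root_negEdge]
    simp [label, SignedEdge.root]
  have h3 : ∀ i, ((familyLabel k ⟨v, .inr (.inl i)⟩).root u : ℝ)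
      = (negEdge v i).root u + if i < k v then
        ((label ⟨v, .inr (.inr ())⟩).root u : ℝ) else 0 := by
    intro i
    by_cases hi : i < k v
    · simp only [familyLabel, hi, if_true, h2]
    · simp [familyLabel, hi]
  have h4 : (familyLabel k ⟨v, .inr (.inr ())⟩) = posEdge v (k v) := rfl
  have h5 : ∀ i, label ⟨v, .inr (.inl i)⟩ = negEdge v i := fun _ => rfl
  simp only [flowChange, LinearEquiv.coe_mk, LinearMap.coe_mk, AddHom.coe_mk, h1, h3, h4, h5, h2]
  simp only [mul_add, add_mul, Finset.sum_add_distrib, Finset.mul_sum, mul_ite, ite_mul, mul_zero,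
    zero_mul, Finset.sum_ite_eq', Finset.mem_univ, if_true]
  ring

/-! ### Boundedness and strictly positive flows -/

/-- Every coordinate of a nonnegative flow whose netflow is concentrated at the first vertex is
bounded by a multiple of the netflow. -/
theorem le_of_netflow_eq {f : EdgeIndex n → ℝ} (hf : ∀ e, 0 ≤ f e) {c : ℝ}
    (hc : netflow label f = Pi.single 0 c) (e : EdgeIndex n) : f e ≤ (n + 1) * c := by
  -- These weights decrease from `n + 1` to `1` in unit steps, so every root has weight at least
  -- one: a negative edge by the decrease, a positive one by positivity.
  let W : Fin (n + 1) → ℝ := fun u => n + 1 - (u : ℕ)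
  have hsingle : ∀ a : Fin (n + 1),
      ∑ u, W u * ((Pi.single a 1 : Fin (n + 1) → ℤ) u : ℝ) = W a := by
    intro a
    rw [Finset.sum_eq_single a]
    · simp
    · intro b _ hb
      simp [hb]
    · simp
  have hW : ∀ e : EdgeIndex n, 1 ≤ ∑ u, W u * ((label e).root u : ℝ) := by
    rintro ⟨v, i | i | _⟩
    all_goals
      have hv : ((v : ℕ) : ℝ) + 1 ≤ n := by exact_mod_cast v.isLt
      simp only [label, posEdge, negEdge, SignedEdge.root, Pi.add_apply, Pi.sub_apply,
        Int.cast_add, Int.cast_sub, mul_add, mul_sub, Finset.sum_add_distrib,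
        Finset.sum_sub_distrib, hsingle]
      simp only [W, earlierVertex, Fin.val_succ, Nat.cast_add, Nat.cast_one]
    · have hi : ((i : ℕ) : ℝ) ≤ v := by exact_mod_cast Nat.lt_succ_iff.1 i.isLt
      linarith
    · have hi : ((i : ℕ) : ℝ) ≤ v := by exact_mod_cast Nat.lt_succ_iff.1 i.isLt
      linarith
    · linarith
  have hsum : ∑ u, W u * netflow label f u = (n + 1) * c := by
    rw [hc, Finset.sum_eq_single 0]
    · simp [W]
    · intro b _ hb
      simp [hb]
    · simp
  have hswap : ∑ u, W u * netflow label f u = ∑ e, (∑ u, W u * ((label e).root u : ℝ)) * f e := by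
    simp only [netflow_apply, Finset.mul_sum, Finset.sum_mul]
    rw [Finset.sum_comm]
    simp only [mul_assoc]
  rw [← hsum, hswap]
  calc f e ≤ (∑ u, W u * ((label e).root u : ℝ)) * f e :=
        le_mul_of_one_le_left (hf e) (hW e)
    _ ≤ _ := Finset.single_le_sum
        (f := fun e => (∑ u, W u * ((label e).root u : ℝ)) * f e)
        (fun e _ => mul_nonneg (zero_le_one.trans (hW e)) (hf e)) (Finset.mem_univ e)

/-- A signed graph has a strictly positive flow with netflow `(2, 0, …, 0)` if the sum of its
roots is nonnegative, and positive at the first vertex, and there are nonnegative flows from the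
first vertex to all others. -/
theorem exists_pos_flow {E : Type} [Fintype E] (lab : E → SignedEdge n)
    (hsum : ∀ u, 0 ≤ netflow lab (fun _ => 1) u) (hzero : 0 < netflow lab (fun _ => 1) 0)
    (hpath : ∀ u, ∃ g : E → ℝ, (∀ e, 0 ≤ g e) ∧
      netflow lab g = Pi.single 0 1 - Pi.single u 1) :
    ∃ f : E → ℝ, (∀ e, 0 < f e) ∧ netflow lab f = fun v => (netflowTwo n v : ℝ) := by
  choose g hg hgu using hpath
  set b := netflow lab (fun _ => 1) with hb
  set s := ∑ u, b u with hs
  have hspos : 0 < s := Finset.sum_pos' (fun u _ => hsum u) ⟨0, Finset.mem_univ 0, hzero⟩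
  -- The constant flow has netflow `b`. Adding `b u` times a flow from the first vertex to `u` moves
  -- all of it to the first vertex, where it totals `s`.
  refine ⟨(2 / s) • ((fun _ => 1) + ∑ u, b u • g u), fun e => ?_, ?_⟩
  · have : 0 ≤ ∑ u, b u * g u e := Finset.sum_nonneg fun u _ => mul_nonneg (hsum u) (hg u e)
    simp only [Pi.smul_apply, Pi.add_apply, Finset.sum_apply, smul_eq_mul]
    positivity
  · rw [map_smul, map_add, map_sum]
    simp only [map_smul, hgu, ← hb]
    ext v
    have h1 : ∑ u, b u * ((Pi.single u 1 : Fin (n + 1) → ℝ) v) = b v := by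
      simp [Pi.single_apply]
    simp only [Pi.smul_apply, Pi.add_apply, Finset.sum_apply, smul_eq_mul, Pi.sub_apply, mul_sub,
      Finset.sum_sub_distrib, h1, ← Finset.sum_mul, ← hs]
    by_cases hv : v = 0
    · subst hv
      simp only [netflowTwo, Pi.single_eq_same]
      field_simp
      simp [mul_comm]
    · simp [netflowTwo, hv]

theorem single_one_nonneg {α : Type*} [DecidableEq α] (a b : α) :
    (0 : ℤ) ≤ (Pi.single a 1 : α → ℤ) b := by
  rw [Pi.single_apply]; split_ifs <;> simp

theorem exists_pos_flow_family [NeZero n] (k : (v : Fin n) → Fin (v + 1)) :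
    ∃ f : EdgeIndex n → ℝ, (∀ e, 0 < f e) ∧
      netflow (familyLabel k) f = fun v => (netflowTwo n v : ℝ) := by
  have hs := @single_one_nonneg (Fin (n + 1)) _
  -- The only negative contributions come from the negative edges; each cancels against the parallel
  -- positive edge.
  have hpair : ∀ u (v : Fin n) (i : Fin (v + 1)),
      (0 : ℝ) ≤ (posEdge v i).root u + (familyLabel k ⟨v, .inr (.inl i)⟩).root u := by
    intro u v i
    have h1 := hs (earlierVertex v i) u
    have h2 := hs v.succ u
    by_cases hi : i < k v
    · simp only [familyLabel, hi, if_true]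
      rw [root_posEdge]
      norm_cast
      simp only [Pi.add_apply]
      omega
    · simp only [familyLabel, hi, if_false]
      rw [root_posEdge, root_negEdge]
      norm_cast
      simp only [Pi.add_apply, Pi.sub_apply]
      omega
  have hloop : ∀ u (v : Fin n), (0 : ℝ) ≤ (posEdge v (k v)).root u := by
    intro u v
    have h1 := hs (earlierVertex v (k v)) u
    have h2 := hs v.succ u
    rw [root_posEdge]
    norm_cast
    simp only [Pi.add_apply]
    omega
  have hexp : ∀ u, netflow (familyLabel k) (fun _ => 1) u
      = ∑ v : Fin n, (∑ i, (((posEdge v i).root u : ℝ)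
        + (familyLabel k ⟨v, .inr (.inl i)⟩).root u) + (posEdge v (k v)).root u) := by
    intro u
    rw [netflow_apply, sum_edgeIndex]
    refine Finset.sum_congr rfl fun v _ => ?_
    rw [Finset.sum_add_distrib]
    simp only [mul_one, ← add_assoc]
    rfl
  apply exists_pos_flow
  · intro u
    rw [hexp]
    exact Finset.sum_nonneg fun v _ =>
      add_nonneg (Finset.sum_nonneg fun i _ => hpair u v i) (hloop u v)
  · rw [hexp]
    refine Finset.sum_pos' (fun v _ =>
      add_nonneg (Finset.sum_nonneg fun i _ => hpair 0 v i) (hloop 0 v))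
      ⟨0, Finset.mem_univ _, add_pos_of_nonneg_of_pos
        (Finset.sum_nonneg fun i _ => hpair 0 0 i) ?_⟩
    have hk : earlierVertex 0 (k 0) = (0 : Fin (n + 1)) := by
      have := (k 0).isLt
      ext
      simp only [earlierVertex, Fin.val_zero] at this ⊢
      simp at this
      omega
    rw [root_posEdge, hk]
    simp
  · intro u
    induction u using WellFoundedLT.induction with
    | ind u ih =>
      rcases Fin.eq_zero_or_eq_succ u with rfl | ⟨v, rfl⟩
      · exact ⟨0, fun _ => le_rfl, by simp⟩
      -- The negative edge from `k v` to `v.succ` is present for every choice, so a path to `k v`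
      -- extends to `v.succ`.
      · obtain ⟨g, hg, hgu⟩ := ih _ (earlierVertex_lt v (k v))
        refine ⟨g + Pi.single ⟨v, .inr (.inl (k v))⟩ 1, fun e => ?_, ?_⟩
        · refine add_nonneg (hg e) ?_
          rw [Pi.single_apply]
          split_ifs <;> simp
        · ext u
          rw [map_add, Pi.add_apply, netflow_single, hgu]
          simp [familyLabel, root_negEdge, Pi.single_apply]

/-- `flowChange` preserves strict positivity, so a family member supplies a positive flow off the
first loop. Averaging it with the unit flow on that loop keeps the netflow and makes all coordinates
positive. -/
theorem exists_pos_flow_complete [NeZero n] :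
    ∃ f : Option (EdgeIndex n) → ℝ, (∀ e, 0 < f e) ∧
      netflow completeLabel f = fun v => (netflowTwo n v : ℝ) := by
  obtain ⟨g, hg, hgu⟩ := exists_pos_flow_family fun v : Fin n => (0 : Fin (v + 1))
  rw [← netflow_flowChange] at hgu
  have hpos : ∀ e, 0 < flowChange (fun v : Fin n => (0 : Fin (v + 1))) g e := by
    rintro ⟨v, i | i | _⟩
    · exact hg _
    · refine add_pos_of_pos_of_nonneg (hg _) ?_
      split_ifs
      exacts [(hg _).le, le_rfl]
    · exact add_pos_of_pos_of_nonneg (hg _) (Finset.sum_nonneg fun _ _ => (hg _).le)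
  generalize flowChange (fun v : Fin n => (0 : Fin (v + 1))) g = f at hgu hpos
  refine ⟨fun e => e.elim (1 / 2) fun e => 1 / 2 * f e, ?_, ?_⟩
  · rintro (_ | e)
    · simp
    · simpa using hpos e
  · ext u
    have hu := congrFun hgu u
    rw [netflow_apply] at hu ⊢
    rw [Fintype.sum_option]
    simp only [completeLabel, Option.elim, mul_left_comm _ (1 / 2 : ℝ), ← Finset.mul_sum, hu]
    simp only [SignedEdge.root, netflowTwo, Pi.add_apply, Pi.single_apply]
    split_ifs <;> norm_num

/-! ### Integral coordinates on the flows of netflow zero -/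

/-- The edges on which the value of a flow is determined by the netflow and by the values on the
other edges: the negative edges at the first vertex and one positive edge. -/
def dependent [NeZero n] : EdgeIndex n → Bool
  | ⟨v, .inl _⟩ => decide (v = 0)
  | ⟨_, .inr (.inl i)⟩ => decide (i = 0)
  | ⟨_, .inr (.inr _)⟩ => false

/-- The edges on which the values of a flow with prescribed netflow are free. -/
abbrev Free (n : ℕ) [NeZero n] : Type := {e : EdgeIndex n // dependent e = false}

/-- The positive edge between the first two vertices. -/
def firstPos [NeZero n] : EdgeIndex n := ⟨0, .inl 0⟩

/-- The negative edge between the first vertex and `v.succ`. -/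
def rootNeg (v : Fin n) : EdgeIndex n := ⟨v, .inr (.inl 0)⟩

theorem inl_eq_firstPos [NeZero n] (v : Fin n) (i : Fin (v + 1)) :
    (⟨v, .inl i⟩ : EdgeIndex n) = firstPos ↔ v = 0 := by
  constructor
  · intro h
    exact congrArg Sigma.fst h
  · rintro rfl
    have hi : i = 0 := Fin.ext (by have := i.isLt; simp at this ⊢; omega)
    rw [hi]
    rfl

theorem inr_ne_firstPos [NeZero n] (v : Fin n) (i : Fin (v + 1) ⊕ Unit) :
    (⟨v, .inr i⟩ : EdgeIndex n) ≠ firstPos := by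
  intro h
  rw [firstPos, Sigma.mk.injEq] at h
  obtain ⟨rfl, h⟩ := h
  exact Sum.inr_ne_inl (eq_of_heq h)

theorem inl_ne_rootNeg (v w : Fin n) (i : Fin (v + 1)) :
    (⟨v, .inl i⟩ : EdgeIndex n) ≠ rootNeg w := by
  intro h
  rw [rootNeg, Sigma.mk.injEq] at h
  obtain ⟨rfl, h⟩ := h
  exact Sum.inl_ne_inr (eq_of_heq h)

theorem loop_ne_rootNeg (v w : Fin n) : (⟨v, .inr (.inr ())⟩ : EdgeIndex n) ≠ rootNeg w := by
  intro h
  rw [rootNeg, Sigma.mk.injEq] at h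
  obtain ⟨rfl, h⟩ := h
  exact Sum.inr_ne_inl (Sum.inr_injective (eq_of_heq h))

theorem neg_eq_rootNeg_iff (v w : Fin n) (i : Fin (v + 1)) :
    (⟨v, .inr (.inl i)⟩ : EdgeIndex n) = rootNeg w ↔ v = w ∧ i = 0 := by
  constructor
  · intro h
    rw [rootNeg, Sigma.mk.injEq] at h
    obtain ⟨rfl, h⟩ := h
    exact ⟨rfl, by simpa using h⟩
  · rintro ⟨rfl, rfl⟩
    rfl

theorem root_label_rootNeg (v : Fin n) :
    (label (rootNeg v)).root = Pi.single 0 1 - Pi.single v.succ 1 := rfl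

/-- The sum of the values of a flow on the positive edges. -/
noncomputable def posTotal : (EdgeIndex n → ℝ) →ₗ[ℝ] ℝ where
  toFun f := ∑ v : Fin n, (∑ i, f ⟨v, .inl i⟩ + f ⟨v, .inr (.inr ())⟩)
  map_add' f g := by
    simp only [Pi.add_apply, Finset.sum_add_distrib]
    ring
  map_smul' c f := by
    simp only [Pi.smul_apply, smul_eq_mul, Finset.sum_add_distrib, ← Finset.mul_sum,
      RingHom.id_apply]
    ring

theorem posTotal_apply (f : EdgeIndex n → ℝ) :
    posTotal f = ∑ v : Fin n, (∑ i, f ⟨v, .inl i⟩ + f ⟨v, .inr (.inr ())⟩) := rfl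

/-- The coordinates of a negative root sum to zero and those of a positive one to two. Thus netflow
zero forces `posTotal` to vanish, a condition solvable over the integers by changing a single
positive edge. -/
theorem sum_netflow (f : EdgeIndex n → ℝ) : ∑ u, netflow label f u = 2 * posTotal f := by
  have hsingle : ∀ a : Fin (n + 1), ∑ u, ((Pi.single a 1 : Fin (n + 1) → ℤ) u : ℝ) = 1 := by
    intro a
    simp [Pi.single_apply]
  simp only [netflow_apply]
  rw [Finset.sum_comm, sum_edgeIndex, posTotal_apply, Finset.mul_sum]
  refine Finset.sum_congr rfl fun v _ => ?_
  simp only [← Finset.sum_mul, label, posEdge, negEdge, SignedEdge.root, Pi.add_apply,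
    Pi.sub_apply, Int.cast_add, Int.cast_sub, Finset.sum_add_distrib, Finset.sum_sub_distrib,
    hsingle, mul_add, Finset.mul_sum]
  norm_num

/-- Correct a flow on one positive edge so that its total on the positive edges vanishes. -/
noncomputable def balancePos [NeZero n] : (EdgeIndex n → ℝ) →ₗ[ℝ] (EdgeIndex n → ℝ) :=
  LinearMap.id - posTotal.smulRight (Pi.single firstPos 1)

/-- Correct a flow on the negative edges at the first vertex so that its netflow vanishes at all
other vertices. -/
noncomputable def balanceNeg : (EdgeIndex n → ℝ) →ₗ[ℝ] (EdgeIndex n → ℝ) :=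
  LinearMap.id + ∑ v : Fin n,
    ((LinearMap.proj v.succ).comp (netflow label)).smulRight (Pi.single (rootNeg v) 1)

/-- The parametrization of the flows of netflow zero by their values on the free edges. -/
noncomputable def flowParam [NeZero n] : (Free n → ℝ) →ₗ[ℝ] (EdgeIndex n → ℝ) :=
  balanceNeg ∘ₗ balancePos ∘ₗ Function.ExtendByZero.linearMap ℝ Subtype.val

theorem balancePos_apply [NeZero n] (f : EdgeIndex n → ℝ) (e : EdgeIndex n) :
    balancePos f e = f e - posTotal f * (Pi.single firstPos 1 : EdgeIndex n → ℝ) e := by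
  simp [balancePos]

theorem balanceNeg_apply (f : EdgeIndex n → ℝ) :
    balanceNeg f = f + ∑ v : Fin n, netflow label f v.succ •
      (Pi.single (rootNeg v) 1 : EdgeIndex n → ℝ) := by
  simp [balanceNeg]

theorem posTotal_balancePos [NeZero n] (f : EdgeIndex n → ℝ) : posTotal (balancePos f) = 0 := by
  have h : posTotal (Pi.single firstPos 1 : EdgeIndex n → ℝ) = 1 := by
    rw [posTotal_apply]
    simp only [Pi.single_apply, inl_eq_firstPos, inr_ne_firstPos]
    simp
  simp [balancePos, h]

theorem balanceNeg_apply_of_ne (f : EdgeIndex n → ℝ) (e : EdgeIndex n)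
    (he : ∀ v, e ≠ rootNeg v) : balanceNeg f e = f e := by
  rw [balanceNeg_apply]
  simp [he]

theorem netflow_balanceNeg_succ (f : EdgeIndex n → ℝ) (v : Fin n) :
    netflow label (balanceNeg f) v.succ = 0 := by
  rw [balanceNeg_apply, map_add, map_sum, Pi.add_apply, Finset.sum_apply, Finset.sum_eq_single v]
  · rw [map_smul, Pi.smul_apply, netflow_single]
    simp [root_label_rootNeg]
  · intro w _ hw
    rw [map_smul, Pi.smul_apply, netflow_single]
    simp [root_label_rootNeg, hw.symm]
  · simp

theorem netflow_eq_zero_of_succ {f : EdgeIndex n → ℝ} (h : ∀ v : Fin n, netflow label f v.succ = 0)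
    (hpos : posTotal f = 0) : netflow label f = 0 := by
  have hsum := sum_netflow f
  rw [Fin.sum_univ_succ, hpos] at hsum
  simp only [h, Finset.sum_const_zero, add_zero, mul_zero] at hsum
  ext u
  rcases Fin.eq_zero_or_eq_succ u with rfl | ⟨v, rfl⟩
  exacts [hsum, h v]

/-- The order of the corrections matters: `balanceNeg` changes only negative edges and so preserves
the vanishing of `posTotal` achieved by `balancePos`. Conservation at the first vertex then follows
from that at the others. -/
theorem netflow_flowParam [NeZero n] (x : Free n → ℝ) : netflow label (flowParam x) = 0 := by
  refine netflow_eq_zero_of_succ (netflow_balanceNeg_succ _) ?_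
  rw [← posTotal_balancePos (Function.ExtendByZero.linearMap ℝ Subtype.val x), posTotal_apply,
    posTotal_apply]
  refine Finset.sum_congr rfl fun v _ => ?_
  congr 1
  · exact Finset.sum_congr rfl fun i _ => balanceNeg_apply_of_ne _ _ fun w => inl_ne_rootNeg v w i
  · exact balanceNeg_apply_of_ne _ _ fun w => loop_ne_rootNeg v w

theorem free_ne_rootNeg [NeZero n] (e : Free n) (v : Fin n) : (e : EdgeIndex n) ≠ rootNeg v := by
  intro h
  have := e.2
  rw [h] at this
  simp [rootNeg, dependent] at this

theorem free_ne_firstPos [NeZero n] (e : Free n) : (e : EdgeIndex n) ≠ firstPos := by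
  intro h
  have := e.2
  rw [h] at this
  simp [firstPos, dependent] at this

theorem flowParam_apply_free [NeZero n] (x : Free n → ℝ) (e : Free n) :
    flowParam x e = x e := by
  rw [flowParam, LinearMap.comp_apply, balanceNeg_apply_of_ne _ _ (free_ne_rootNeg e),
    LinearMap.comp_apply, balancePos_apply, Pi.single_eq_of_ne (free_ne_firstPos e), mul_zero, sub_zero]
  exact Subtype.val_injective.extend_apply x 0 e

theorem flowParam_injective [NeZero n] : Function.Injective (flowParam (n := n)) := by
  intro x y h
  ext e
  rw [← flowParam_apply_free x, h, flowParam_apply_free]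

/-- A flow of netflow zero that vanishes on the free edges vanishes. -/
theorem eq_zero_of_free_eq_zero [NeZero n] {f : EdgeIndex n → ℝ} (hf : netflow label f = 0)
    (hfree : ∀ e, dependent e = false → f e = 0) : f = 0 := by
  have hpos : f firstPos = 0 := by
    have hsum := sum_netflow f
    have hv : ∀ v : Fin n, (∑ i, f ⟨v, .inl i⟩ + f ⟨v, .inr (.inr ())⟩)
        = if v = 0 then f firstPos else 0 := by
      intro v
      rw [hfree ⟨v, .inr (.inr ())⟩ rfl, add_zero]
      split_ifs with hv
      · have hi : ∀ i, f ⟨v, .inl i⟩ = f firstPos := fun i => by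
          rw [(inl_eq_firstPos v i).2 hv]
        simp [hi, hv]
      · exact Finset.sum_eq_zero fun i _ => hfree _ (by simp [dependent, hv])
    rw [hf, posTotal_apply] at hsum
    simpa [hv] using hsum.symm
  have hpos' : ∀ (v : Fin n) i, f ⟨v, .inl i⟩ = 0 := by
    intro v i
    by_cases hv : v = 0
    · rw [(inl_eq_firstPos v i).2 hv, hpos]
    · exact hfree _ (by simp [dependent, hv])
  have hne : ∀ e : EdgeIndex n, (∀ v, e ≠ rootNeg v) → f e = 0 := by
    rintro ⟨v, i | i | _⟩ h
    · exact hpos' v i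
    · refine hfree _ ?_
      have := h v
      rw [Ne, neg_eq_rootNeg_iff] at this
      simpa [dependent] using this
    · exact hfree _ rfl
  have hneg : ∀ v, f (rootNeg v) = 0 := by
    intro v
    have h := congrFun hf v.succ
    rw [netflow_apply, Finset.sum_eq_single (rootNeg v)] at h
    · simpa [root_label_rootNeg] using h
    · intro e _ he
      by_cases h0 : ∀ w, e ≠ rootNeg w
      · rw [hne e h0, mul_zero]
      · push Not at h0
        obtain ⟨w, rfl⟩ := h0
        have hw : w ≠ v := fun h => he (by rw [h])
        simp [root_label_rootNeg, hw.symm]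
    · simp
  ext e
  by_cases h0 : ∀ w, e ≠ rootNeg w
  · exact hne e h0
  · push Not at h0
    obtain ⟨w, rfl⟩ := h0
    exact hneg w

theorem range_flowParam [NeZero n] :
    LinearMap.range (flowParam (n := n)) = LinearMap.ker (netflow label) := by
  apply le_antisymm
  · rintro _ ⟨x, rfl⟩
    exact netflow_flowParam x
  · intro f hf
    refine ⟨fun e => f e, sub_eq_zero.1 (eq_zero_of_free_eq_zero ?_ fun e he => ?_)⟩
    · rw [map_sub, netflow_flowParam, hf, sub_zero]
    · rw [Pi.sub_apply, flowParam_apply_free _ ⟨e, he⟩, sub_self]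

theorem flowParam_integral_iff [NeZero n] (x : Free n → ℝ) :
    (∀ e, ∃ z : ℤ, flowParam x e = z) ↔ ∀ e, ∃ z : ℤ, x e = z := by
  constructor
  · intro h e
    rw [← flowParam_apply_free x e]
    exact h e
  · intro h
    let Z : Subring ℝ := (Int.castRingHom ℝ).range
    have hZ : ∀ r : ℝ, r ∈ Z ↔ ∃ z : ℤ, r = z := fun r => by
      simp [Z, RingHom.mem_range, eq_comm]
    have hint : ∀ z : ℤ, (z : ℝ) ∈ Z := fun z => (hZ _).2 ⟨z, rfl⟩
    have hsingle : ∀ a b : EdgeIndex n, (Pi.single a 1 : EdgeIndex n → ℝ) b ∈ Z := by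
      intro a b
      rw [Pi.single_apply]
      split_ifs
      exacts [Z.one_mem, Z.zero_mem]
    have h0 : ∀ e,
        Function.ExtendByZero.linearMap ℝ (Subtype.val : Free n → EdgeIndex n) x e ∈ Z := by
      intro e
      by_cases he : ∃ e' : Free n, e'.val = e
      · obtain ⟨e, rfl⟩ := he
        rw [show Function.ExtendByZero.linearMap ℝ (Subtype.val : Free n → EdgeIndex n) x e = x e
          from Subtype.val_injective.extend_apply x 0 e]
        exact (hZ _).2 (h e)
      · rw [show Function.ExtendByZero.linearMap ℝ (Subtype.val : Free n → EdgeIndex n) x e = 0 from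
          Function.extend_apply' (f := Subtype.val) x (0 : EdgeIndex n → ℝ) e he]
        exact Z.zero_mem
    have h1 : ∀ f : EdgeIndex n → ℝ, (∀ e, f e ∈ Z) → ∀ e, balancePos f e ∈ Z := by
      intro f hf e
      rw [balancePos_apply, posTotal_apply]
      exact Z.sub_mem (hf e) (Z.mul_mem (Z.sum_mem fun v _ =>
        Z.add_mem (Z.sum_mem fun i _ => hf _) (hf _)) (hsingle _ _))
    have h2 : ∀ f : EdgeIndex n → ℝ, (∀ e, f e ∈ Z) → ∀ e, balanceNeg f e ∈ Z := by
      intro f hf e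
      rw [balanceNeg_apply, Pi.add_apply, Finset.sum_apply]
      exact Z.add_mem (hf e) (Z.sum_mem fun v _ => Z.mul_mem
        (Z.sum_mem fun e _ => Z.mul_mem (hint _) (hf e)) (hsingle _ _))
    exact fun e => (hZ _).1 (h2 _ (h1 _ h0) e)

/-- A flow with netflow `(2, 0, …, 0)` that vanishes on the free edges. -/
noncomputable def baseFlow [NeZero n] : EdgeIndex n → ℝ :=
  Pi.single firstPos 1 + Pi.single (rootNeg 0) 1

theorem netflow_baseFlow [NeZero n] :
    netflow label baseFlow = fun v => (netflowTwo n v : ℝ) := by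
  ext u
  rw [baseFlow, map_add, Pi.add_apply, netflow_single, netflow_single]
  rw [show (label (firstPos : EdgeIndex n)).root = Pi.single 0 1 + Pi.single (Fin.succ 0) 1
    from rfl, root_label_rootNeg]
  simp only [netflowTwo, Pi.add_apply, Pi.sub_apply, Pi.single_apply]
  split_ifs <;> norm_num

theorem baseFlow_integral [NeZero n] (e : EdgeIndex n) : ∃ z : ℤ, baseFlow e = z := by
  refine ⟨(Pi.single firstPos 1 + Pi.single (rootNeg 0) 1 : EdgeIndex n → ℤ) e, ?_⟩
  simp only [baseFlow, Pi.add_apply, Pi.single_apply]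
  split_ifs <;> norm_num

theorem baseFlow_free [NeZero n] (e : Free n) : baseFlow (e : EdgeIndex n) = 0 := by
  simp [baseFlow, free_ne_rootNeg, free_ne_firstPos]

end EdgeIndex

/-! ### Pyramids and null hyperplanes -/

theorem lintegral_one_sub_pow (d : ℕ) :
    ∫⁻ t in Set.Ico (0 : ℝ) 1, ENNReal.ofReal ((1 - t) ^ d) = ENNReal.ofReal (1 / (d + 1)) := by
  rw [← ofReal_integral_eq_lintegral_ofReal]
  · congr 1
    rw [integral_Ico_eq_integral_Ioc, ← intervalIntegral.integral_of_le zero_le_one,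
      intervalIntegral.integral_comp_sub_left (fun x => x ^ d) 1, integral_pow]
    simp
  · have : Continuous fun t : ℝ => (1 - t) ^ d := by fun_prop
    exact (this.integrableOn_Icc (a := 0) (b := 1)).mono_set Set.Ico_subset_Icc_self
  · filter_upwards [ae_restrict_mem measurableSet_Ico] with t ht
    exact pow_nonneg (by linarith [ht.2]) _

/-- The volume of a pyramid of height one, in terms of the volume of its base. -/
theorem volume_pyramid {κ : Type*} [Fintype κ] {C : Set (Option κ → ℝ)} (hC : MeasurableSet C)
    (Q : Set (κ → ℝ)) (hheight : ∀ y ∈ C, 0 ≤ y none ∧ y none ≤ 1)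
    (hslice : ∀ y : Option κ → ℝ, 0 ≤ y none → y none < 1 →
      (y ∈ C ↔ (1 - y none)⁻¹ • (fun i => y (some i)) ∈ Q)) :
    volume.real C = volume.real Q / (Fintype.card κ + 1) := by
  let ε := (MeasurableEquiv.piOptionEquivProd fun _ : Option κ => ℝ).symm
  have hnone : ∀ x t, ε (x, t) none = t := fun _ _ => rfl
  have hsome : ∀ x t, (fun i => ε (x, t) (some i)) = x := fun _ _ => rfl
  have hvol : volume C = volume (ε ⁻¹' C) := by
    rw [volume_pi, ← Measure.pi_map_piOptionEquivProd fun _ : Option κ => (volume : Measure ℝ),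
      MeasurableEquiv.map_apply]
    rfl
  have hint : volume (ε ⁻¹' C)
      = ∫⁻ t : ℝ, (Set.Ico (0 : ℝ) 1).indicator
          (fun t => ENNReal.ofReal ((1 - t) ^ Fintype.card κ) * volume Q) t := by
    rw [Measure.volume_eq_prod, Measure.prod_apply_symm (ε.measurable hC)]
    refine lintegral_congr_ae ?_
    -- The slice at the apex is not governed by `hslice`, but a single height is negligible.
    have hne : ∀ᵐ t : ℝ, t ≠ 1 := by simp [ae_iff]
    filter_upwards [hne] with t ht
    by_cases hmem : t ∈ Set.Ico (0 : ℝ) 1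
    · rw [Set.indicator_of_mem hmem]
      have hpos : 0 < 1 - t := by linarith [hmem.2]
      have hset : (fun x => (x, t)) ⁻¹' (ε ⁻¹' C) = ((1 - t)⁻¹ • ·) ⁻¹' Q := by
        ext x
        have := hslice (ε (x, t)) hmem.1 hmem.2
        rwa [hnone, hsome] at this
      rw [hset, Measure.addHaar_preimage_smul _ (inv_ne_zero hpos.ne'),
        Module.finrank_fintype_fun_eq_card, inv_pow, inv_inv, abs_of_nonneg (by positivity)]
    · rw [Set.indicator_of_notMem hmem]
      convert measure_empty (μ := (volume : Measure (κ → ℝ)))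
      rw [Set.eq_empty_iff_forall_notMem]
      intro x hx
      obtain ⟨h0, h1⟩ := hheight _ hx
      rw [hnone] at h0 h1
      exact hmem ⟨h0, lt_of_le_of_ne h1 ht⟩
  rw [Measure.real, hvol, hint, lintegral_indicator measurableSet_Ico,
    lintegral_mul_const _ (by fun_prop), lintegral_one_sub_pow, ENNReal.toReal_mul,
    ENNReal.toReal_ofReal (by positivity), Measure.real]
  ring

/-- The level sets of a nonzero linear functional are null sets. -/
theorem volume_levelSet_eq_zero {κ : Type*} [Fintype κ] (l : (κ → ℝ) →ₗ[ℝ] ℝ) (hl : l ≠ 0)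
    (c : ℝ) : volume {x | l x = c} = 0 := by
  rcases Set.eq_empty_or_nonempty {x | l x = c} with h | ⟨x₀, hx₀⟩
  · rw [h, measure_empty]
  · have hset : {x | l x = c} = (fun x => x + -x₀) ⁻¹' (LinearMap.ker l : Set (κ → ℝ)) := by
      ext x
      have h0 : l x₀ = c := hx₀
      simp only [Set.mem_ofPred_eq, Set.mem_preimage, SetLike.mem_coe, LinearMap.mem_ker, map_add,
        map_neg, h0]
      exact (add_neg_eq_zero).symm
    rw [hset, measure_preimage_add_right]
    exact Measure.addHaar_submodule _ _ fun h => hl (LinearMap.ker_eq_top.1 h)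

/-! ### Polytope volumes as volumes of regions in the free coordinates -/

namespace EdgeIndex

variable {n : ℕ}

/-- The flows on the complete signed graph without its first loop, with netflow `(2, 0, …, 0)`, in
the coordinates given by the free edges. -/
def flowRegion (n : ℕ) [NeZero n] : Set (Free n → ℝ) :=
  {x | ∀ e, 0 ≤ (flowParam x + baseFlow : EdgeIndex n → ℝ) e}

/-- The part of the flow region that comes from the graph of the family with the choice `k`. -/
def flowPiece [NeZero n] (k : (v : Fin n) → Fin (v + 1)) : Set (Free n → ℝ) :=
  {x | ∀ e, 0 ≤ (flowChange k).symm (flowParam x + baseFlow) e}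

theorem flowChange_symm_integral_iff (k : (v : Fin n) → Fin (v + 1)) (f : EdgeIndex n → ℝ) :
    (∀ e, ∃ z : ℤ, (flowChange k).symm f e = z) ↔ ∀ e, ∃ z : ℤ, f e = z := by
  let Z : Subring ℝ := (Int.castRingHom ℝ).range
  have hZ : ∀ r : ℝ, (∃ z : ℤ, r = z) ↔ r ∈ Z := fun r => by
    simp [Z, RingHom.mem_range, eq_comm]
  simp only [hZ]
  have hite : ∀ (p : Prop) [Decidable p] (r : ℝ), r ∈ Z → (if p then r else 0) ∈ Z := by
    intro p _ r hr
    split_ifs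
    exacts [hr, Z.zero_mem]
  constructor
  · intro h
    rw [← (flowChange k).apply_symm_apply f]
    generalize (flowChange k).symm f = g at h
    rintro ⟨v, i | i | _⟩
    · exact h _
    · exact Z.add_mem (h _) (hite _ _ (h _))
    · exact Z.add_mem (h _) (Z.sum_mem fun _ _ => h _)
  · rintro h ⟨v, i | i | _⟩
    · exact h _
    · exact Z.sub_mem (h _) (hite _ _ (Z.sub_mem (h _) (Z.sum_mem fun _ _ => h _)))
    · exact Z.sub_mem (h _) (Z.sum_mem fun _ _ => h _)

theorem normalizedVolume_family [NeZero n] (k : (v : Fin n) → Fin (v + 1)) :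
    normalizedVolume (SignedGraph.flowPolytope (∑ v, edgeSetS v (k v)) (netflowTwo n))
      = (Fintype.card (Free n))! * volume.real (flowPiece k) := by
  obtain ⟨f, hf, hfa⟩ := exists_pos_flow_family k
  have hnet : ∀ g, netflow (familyLabel k) ((flowChange k).symm g) = netflow label g := fun g => by
    rw [← netflow_flowChange, LinearEquiv.apply_symm_apply]
  rw [normalizedVolume_flowPolytope_eq (familyLabel k) _ (sum_edgeSetS_eq_map k) _ f hf hfa
    ((flowChange k).symm.toLinearMap ∘ₗ flowParam)
    ((flowChange k).symm.injective.comp flowParam_injective) ?_ ?_ ((flowChange k).symm baseFlow)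
    (by rw [hnet, netflow_baseFlow])]
  · simp only [flowPiece, map_add]
    rfl
  · rw [LinearMap.range_comp, range_flowParam]
    ext g
    constructor
    · rintro ⟨x, hx, rfl⟩
      rw [LinearMap.mem_ker]
      exact (hnet x).trans hx
    · intro hg
      refine ⟨flowChange k g, ?_, by simp⟩
      rw [SetLike.mem_coe, LinearMap.mem_ker, netflow_flowChange]
      exact hg
  · intro x
    rw [← flowParam_integral_iff]
    exact flowChange_symm_integral_iff k _

theorem netflow_flowParam_add_baseFlow [NeZero n] (x : Free n → ℝ) (t : ℝ) :
    netflow label (flowParam x + t • baseFlow) = Pi.single 0 (2 * t) := by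
  rw [map_add, map_smul, netflow_flowParam, netflow_baseFlow, zero_add]
  ext v
  simp only [netflowTwo, Pi.smul_apply, Pi.single_apply, smul_eq_mul]
  split_ifs <;> simp [mul_comm]

theorem continuous_flowParam_add [NeZero n] (p : EdgeIndex n → ℝ) :
    Continuous fun x : Free n → ℝ => flowParam x + p := by
  have := (flowParam (n := n)).continuous_of_finiteDimensional
  fun_prop

/-- The parametrization of the flows of netflow zero on the complete signed graph. -/
noncomputable def completeParam [NeZero n] :
    (Option (Free n) → ℝ) →ₗ[ℝ] (Option (EdgeIndex n) → ℝ) where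
  -- Flow put on the first loop is compensated by removing the same multiple of `baseFlow`, which
  -- has the same netflow as that loop.
  toFun y e := e.elim (y none) fun e => flowParam (fun i => y (some i)) e - y none * baseFlow e
  map_add' y z := by
    ext (_ | e)
    · rfl
    · have := congrFun (map_add flowParam (fun i => y (some i)) (fun i => z (some i))) e
      simp only [Option.elim, Pi.add_apply] at this ⊢
      rw [← Pi.add_def, this]
      ring
  map_smul' c y := by
    ext (_ | e)
    · rfl
    · have := congrFun (map_smul flowParam c (fun i => y (some i))) e
      simp only [Option.elim, Pi.smul_apply, RingHom.id_apply, smul_eq_mul] at this ⊢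
      rw [mul_sub, ← this, mul_assoc]
      rfl

theorem netflow_completeLabel (f : Option (EdgeIndex n) → ℝ) :
    netflow completeLabel f = Pi.single 0 (2 * f none) + netflow label fun e => f (some e) := by
  ext u
  rw [netflow_apply, Fintype.sum_option, Pi.add_apply, netflow_apply]
  congr 1
  simp only [completeLabel, SignedEdge.root, Pi.add_apply, Pi.single_apply]
  split_ifs <;> norm_num

theorem normalizedVolume_CRYC [NeZero n] :
    normalizedVolume (CRYC n) = (Fintype.card (Free n))! * volume.real (flowRegion n) := by
  obtain ⟨f, hf, hfa⟩ := exists_pos_flow_complete (n := n)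
  have hparam : ∀ y : Option (Free n) → ℝ, (fun e => completeParam y (some e))
      = flowParam (fun i => y (some i)) + (-y none) • baseFlow := by
    intro y
    ext e
    simp [completeParam, sub_eq_add_neg]
  have hnone : ∀ y : Option (Free n) → ℝ, completeParam y none = y none := fun _ => rfl
  have hsome : ∀ (y : Option (Free n) → ℝ) e, completeParam y (some e)
      = flowParam (fun i => y (some i)) e - y none * baseFlow e := fun _ _ => rfl
  have hfree : ∀ (y : Option (Free n) → ℝ) (e : Free n),
      completeParam y (some e) = y (some e) := by
    intro y e
    rw [hsome, flowParam_apply_free, baseFlow_free, mul_zero, sub_zero]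
  rw [CRYC, normalizedVolume_flowPolytope_eq completeLabel _ completeGraphC_eq_map _ f hf hfa
    completeParam ?_ ?_ ?_ (fun e => e.elim 0 baseFlow) ?_]
  -- The factor `1 / (d + 1)` of the pyramid turns `(d + 1)!` into `d!`, where `d` is the number of
  -- free edges.
  · rw [volume_pyramid (Q := flowRegion n), Fintype.card_option, Nat.factorial_succ]
    · push_cast
      field_simp
    · have hcont := (completeParam (n := n)).continuous_of_finiteDimensional
      refine IsClosed.measurableSet ?_
      simp only [Set.ofPred_forall]
      refine isClosed_iInter fun e => isClosed_le continuous_const ?_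
      exact ((continuous_apply e).comp hcont).add continuous_const
    · intro y hy
      refine ⟨by simpa [hnone] using hy none, ?_⟩
      have hflow := netflow_flowParam_add_baseFlow (fun i => y (some i)) (1 - y none)
      have hpos : ∀ e, 0 ≤ (flowParam (fun i => y (some i)) + (1 - y none) • baseFlow :
          EdgeIndex n → ℝ) e := by
        intro e
        have := hy (some e)
        rw [hsome] at this
        simp only [Option.elim, Pi.add_apply, Pi.smul_apply, smul_eq_mul] at this ⊢
        linarith
      -- The flow off the first loop has netflow `2 * (1 - y none)` at the first vertex; if `y none`
      -- exceeded one, a nonnegative flow would have a negative upper bound.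
      have hle := (hpos firstPos).trans (le_of_netflow_eq hpos hflow firstPos)
      by_contra hlt
      push Not at hlt
      have : (0 : ℝ) < n + 1 := by positivity
      nlinarith
    · intro y h0 h1
      have hpos : 0 < 1 - y none := by linarith
      have key : ∀ e, (flowParam ((1 - y none)⁻¹ • fun i => y (some i)) + baseFlow :
          EdgeIndex n → ℝ) e
          = (1 - y none)⁻¹ * (completeParam y (some e) + baseFlow e) := by
        intro e
        rw [hsome, map_smul, Pi.add_apply, Pi.smul_apply, smul_eq_mul]
        field_simp
        ring
      constructor
      · intro hy e
        rw [key]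
        exact mul_nonneg (inv_nonneg.2 hpos.le) (hy (some e))
      · rintro hy (_ | e)
        · simpa [hnone] using h0
        · have := hy e
          rw [key] at this
          exact nonneg_of_mul_nonneg_right this (inv_pos.2 hpos)
  · intro y z h
    ext (_ | e)
    · rw [← hnone y, h, hnone]
    · rw [← hfree y, h, hfree]
  · ext g
    rw [LinearMap.mem_ker, netflow_completeLabel]
    constructor
    · rintro ⟨y, rfl⟩
      rw [hparam, netflow_flowParam_add_baseFlow, hnone, ← Pi.single_add]
      simp
    · intro hg
      have hmem : (fun e => g (some e)) + g none • baseFlow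
          ∈ LinearMap.range (flowParam (n := n)) := by
        rw [range_flowParam, LinearMap.mem_ker, map_add, eq_neg_of_add_eq_zero_right hg]
        have := netflow_flowParam_add_baseFlow (n := n) 0 (g none)
        rw [map_zero, zero_add] at this
        rw [this, neg_add_cancel]
      obtain ⟨x, hx⟩ := hmem
      refine ⟨fun i => i.elim (g none) x, ?_⟩
      ext (_ | e)
      · rfl
      · rw [hsome]
        have := congrFun hx e
        simp only [Pi.add_apply, Pi.smul_apply, smul_eq_mul, Option.elim] at this ⊢
        rw [this]
        ring
  · intro y
    constructor
    · rintro h (_ | e)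
      · exact h none
      · rw [← hfree y]
        exact h (some e)
    · rintro h (_ | e)
      · exact h none
      · obtain ⟨a, ha⟩ := (flowParam_integral_iff fun i => y (some i)).2 (fun i => h (some i)) e
        obtain ⟨b, hb⟩ := h none
        obtain ⟨c, hc⟩ := baseFlow_integral e
        exact ⟨a - b * c, by rw [hsome, ha, hb, hc]; push_cast; ring⟩
  · rw [netflow_completeLabel, ← netflow_baseFlow]
    simp

/-! ### Subdivision of the base -/

theorem nonneg_of_flowChange_symm_nonneg {k : (v : Fin n) → Fin (v + 1)} {f : EdgeIndex n → ℝ}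
    (hf : ∀ e, 0 ≤ (flowChange k).symm f e) (e : EdgeIndex n) : 0 ≤ f e := by
  rw [← (flowChange k).apply_symm_apply f]
  generalize (flowChange k).symm f = g at hf
  obtain ⟨v, i | i | _⟩ := e
  · exact hf _
  · refine add_nonneg (hf _) ?_
    split_ifs
    exacts [hf _, le_rfl]
  · exact add_nonneg (hf _) (Finset.sum_nonneg fun _ _ => hf _)

theorem sum_Iic_eq {m : ℕ} (k : Fin m) (g : Fin m → ℝ) :
    ∑ j ∈ Finset.Iic k, g j = ∑ j ∈ Finset.Iio k, g j + g k := by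
  rw [← Finset.Iio_insert, Finset.sum_insert (by simp), add_comm]

/-- A flow on the complete graph comes from a nonnegative flow on the graph with the choice `k`
iff it is nonnegative and, at each vertex, its value on the loop lies between the partial sums up
to `k` of its values on the incoming negative edges. -/
theorem flowChange_symm_nonneg_iff (k : (v : Fin n) → Fin (v + 1)) (f : EdgeIndex n → ℝ) :
    (∀ e, 0 ≤ (flowChange k).symm f e) ↔ (∀ e, 0 ≤ f e) ∧ ∀ v,
      ∑ j ∈ Finset.Iio (k v), f ⟨v, .inr (.inl j)⟩ ≤ f ⟨v, .inr (.inr ())⟩ ∧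
      f ⟨v, .inr (.inr ())⟩ ≤ ∑ j ∈ Finset.Iic (k v), f ⟨v, .inr (.inl j)⟩ := by
  have hneg : ∀ v i, (flowChange k).symm f ⟨v, .inr (.inl i)⟩ = f ⟨v, .inr (.inl i)⟩ -
      if i = k v then f ⟨v, .inr (.inr ())⟩ - ∑ j ∈ Finset.Iio (k v), f ⟨v, .inr (.inl j)⟩
        else 0 := fun _ _ => rfl
  have hloop : ∀ v, (flowChange k).symm f ⟨v, .inr (.inr ())⟩ =
      f ⟨v, .inr (.inr ())⟩ - ∑ j ∈ Finset.Iio (k v), f ⟨v, .inr (.inl j)⟩ := fun _ => rfl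
  constructor
  · refine fun h => ⟨nonneg_of_flowChange_symm_nonneg h, fun v => ⟨?_, ?_⟩⟩
    · have := h ⟨v, .inr (.inr ())⟩
      rw [hloop] at this
      linarith
    · have := h ⟨v, .inr (.inl (k v))⟩
      rw [hneg, if_pos rfl] at this
      rw [sum_Iic_eq]
      linarith
  · rintro ⟨hf, hk⟩ ⟨v, i | i | _⟩
    · exact hf _
    · rw [hneg]
      split_ifs with hi
      · subst hi
        have := (hk v).2
        rw [sum_Iic_eq] at this
        linarith
      · rw [sub_zero]
        exact hf _
    · have := (hk v).1
      rw [hloop]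
      linarith

/-- On a nonnegative flow, the value at a loop is at most the sum of the values on the negative
edges that end there. -/
theorem loop_le_sum_neg {f : EdgeIndex n → ℝ} (hf : ∀ e, 0 ≤ f e) (v : Fin n)
    (hv : netflow label f v.succ = 0) :
    f ⟨v, .inr (.inr ())⟩ ≤ ∑ i, f ⟨v, .inr (.inl i)⟩ := by
  have hs := @single_one_nonneg (Fin (n + 1)) _
  -- Edges whose later endpoint is some `w.succ` other than `v.succ` never enter `v.succ`
  -- negatively, so they only add to the outflow there.
  have hge : ∀ w : Fin n, w ≠ v →
      0 ≤ ∑ i, ((label ⟨w, .inl i⟩).root v.succ : ℝ) * f ⟨w, .inl i⟩ +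
        (∑ i, ((label ⟨w, .inr (.inl i)⟩).root v.succ : ℝ) * f ⟨w, .inr (.inl i)⟩ +
          ((label ⟨w, .inr (.inr ())⟩).root v.succ : ℝ) * f ⟨w, .inr (.inr ())⟩) := by
    intro w hw
    have hsucc : (Pi.single w.succ 1 : Fin (n + 1) → ℤ) v.succ = 0 := by
      simp [hw.symm]
    refine add_nonneg (Finset.sum_nonneg fun i _ => mul_nonneg ?_ (hf _))
      (add_nonneg (Finset.sum_nonneg fun i _ => mul_nonneg ?_ (hf _)) (mul_nonneg ?_ (hf _)))
    · have := hs (earlierVertex w i) v.succ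
      simp only [label, root_posEdge, Pi.add_apply, hsucc]
      exact_mod_cast (by omega)
    · have := hs (earlierVertex w i) v.succ
      simp only [label, root_negEdge, Pi.sub_apply, hsucc]
      exact_mod_cast (by omega)
    · simp [label, SignedEdge.root, hw.symm]
  have hearlier : ∀ i, (Pi.single (earlierVertex v i) 1 : Fin (n + 1) → ℤ) v.succ = 0 := fun i =>
    Pi.single_eq_of_ne (earlierVertex_lt v i).ne' _
  rw [netflow_apply, sum_edgeIndex, ← Finset.add_sum_erase _ _ (Finset.mem_univ v)] at hv
  have hrest := Finset.sum_nonneg fun w (hw : w ∈ Finset.univ.erase v) =>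
    hge w (Finset.ne_of_mem_erase hw)
  have hpos : 0 ≤ ∑ i, f ⟨v, .inl i⟩ := Finset.sum_nonneg fun i _ => hf _
  have hl := hf ⟨v, .inr (.inr ())⟩
  have h1 : ∀ i, (label ⟨v, .inl i⟩).root v.succ = 1 := fun i => by
    rw [label, root_posEdge, Pi.add_apply, hearlier, Pi.single_eq_same, zero_add]
  have h2 : ∀ i, (label ⟨v, .inr (.inl i)⟩).root v.succ = -1 := fun i => by
    rw [label, root_negEdge, Pi.sub_apply, hearlier, Pi.single_eq_same, zero_sub]
  have h3 : (label ⟨v, .inr (.inr ())⟩).root v.succ = 2 := by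
    simp [label, SignedEdge.root]
  simp only [h1, h2, h3, Int.cast_one, one_mul, Int.cast_neg, neg_mul, Int.cast_ofNat,
    Finset.sum_neg_distrib] at hv
  linarith

theorem netflow_flowParam_add_baseFlow_succ [NeZero n] (x : Free n → ℝ) (v : Fin n) :
    netflow label (flowParam x + baseFlow) v.succ = 0 := by
  have := congrFun (netflow_flowParam_add_baseFlow x 1) v.succ
  rw [one_smul] at this
  rw [this]
  simp

theorem flowRegion_eq_iUnion [NeZero n] : flowRegion n = ⋃ k, flowPiece k := by
  ext x
  rw [Set.mem_iUnion]
  constructor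
  · intro hx
    have hex : ∀ v : Fin n, ∃ k : Fin (v + 1),
        ∑ j ∈ Finset.Iio k, (flowParam x + baseFlow : EdgeIndex n → ℝ) ⟨v, .inr (.inl j)⟩
          ≤ (flowParam x + baseFlow : EdgeIndex n → ℝ) ⟨v, .inr (.inr ())⟩ ∧
        (flowParam x + baseFlow : EdgeIndex n → ℝ) ⟨v, .inr (.inr ())⟩
          ≤ ∑ j ∈ Finset.Iic k, (flowParam x + baseFlow : EdgeIndex n → ℝ) ⟨v, .inr (.inl j)⟩ := by
      intro v
      have hle := loop_le_sum_neg hx v (netflow_flowParam_add_baseFlow_succ x v)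
      have hx' : ∀ e, 0 ≤ (flowParam x + baseFlow : EdgeIndex n → ℝ) e := hx
      generalize (flowParam x + baseFlow : EdgeIndex n → ℝ) = f at hle hx'
      let p : Fin (v + 1) → Prop := fun k =>
        f ⟨v, .inr (.inr ())⟩ ≤ ∑ j ∈ Finset.Iic k, f ⟨v, .inr (.inl j)⟩
      have hlast : p (Fin.last v) := by
        have : Finset.Iic (Fin.last (v : ℕ)) = Finset.univ := by
          ext j
          simp [Fin.le_last]
        simpa only [p, this] using hle
      -- The least `k` whose partial sum reaches the loop value works: minimality gives the lower
      -- bound, and for `k = 0` that bound is nonnegativity of the loop flow.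
      obtain ⟨k, hk, hmin⟩ := WellFounded.has_min (wellFounded_lt (α := Fin (v + 1)))
        {k | p k} ⟨_, hlast⟩
      refine ⟨k, ?_, hk⟩
      by_cases h0 : k = 0
      · subst h0
        rw [show Finset.Iio (0 : Fin (v + 1)) = ∅ from by ext j; simp, Finset.sum_empty]
        exact hx' _
      · have hpred : (⟨k - 1, by omega⟩ : Fin (v + 1)) < k := by
          have : (k : ℕ) ≠ 0 := fun h => h0 (Fin.ext h)
          simp only [Fin.lt_def]
          omega
        have hnot := fun h => hmin _ h hpred
        have hset : Finset.Iio k = Finset.Iic (⟨k - 1, by omega⟩ : Fin (v + 1)) := by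
          ext j
          simp only [Finset.mem_Iio, Finset.mem_Iic, Fin.lt_def, Fin.le_def] at hpred ⊢
          omega
        rw [hset]
        exact (not_le.1 hnot).le
    choose k hk using hex
    exact ⟨k, (flowChange_symm_nonneg_iff k _).2 ⟨hx, hk⟩⟩
  · rintro ⟨k, hk⟩
    exact nonneg_of_flowChange_symm_nonneg hk

/-- The difference of the value of a flow on a loop and a partial sum of its values on the
negative edges that end there. -/
noncomputable def loopGap (v : Fin n) (i : Fin (v + 1)) : (EdgeIndex n → ℝ) →ₗ[ℝ] ℝ :=
  LinearMap.proj ⟨v, .inr (.inr ())⟩ - ∑ j ∈ Finset.Iic i, LinearMap.proj ⟨v, .inr (.inl j)⟩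

theorem loopGap_apply (v : Fin n) (i : Fin (v + 1)) (f : EdgeIndex n → ℝ) :
    loopGap v i f = f ⟨v, .inr (.inr ())⟩ - ∑ j ∈ Finset.Iic i, f ⟨v, .inr (.inl j)⟩ := by
  simp [loopGap]

/-- An index `l` above `i` is needed: it leaves room for a circulation that changes the partial sum
up to `i` without touching the loop. -/
theorem loopGap_comp_flowParam_ne_zero [NeZero n] (v : Fin n) (i l : Fin (v + 1)) (hil : i < l) :
    (loopGap v i).comp (flowParam (n := n)) ≠ 0 := by
  have hl0 : (l : ℕ) ≠ 0 := by
    have := Fin.lt_def.1 hil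
    omega
  have hlt := l.isLt
  let w : Fin n := ⟨l - 1, by omega⟩
  have hwv : w ≠ v := by
    intro h
    have := congrArg Fin.val h
    simp only [w] at this
    omega
  have hw : earlierVertex v l = w.succ := by
    ext
    simp only [earlierVertex, Fin.val_succ, w]
    omega
  -- The route from the first vertex to `v.succ` through `l`, minus the direct negative edge. Only
  -- the direct edge enters the partial sum up to `i`, so the gap equals one.
  let g : EdgeIndex n → ℝ :=
    Pi.single ⟨v, .inr (.inl l)⟩ 1 - Pi.single (rootNeg v) 1 + Pi.single (rootNeg w) 1
  have hg : g ∈ LinearMap.range (flowParam (n := n)) := by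
    rw [range_flowParam, LinearMap.mem_ker]
    ext u
    have hlabel : label ⟨v, .inr (.inl l)⟩ = negEdge v l := rfl
    simp only [g, map_add, map_sub, Pi.add_apply, Pi.sub_apply, netflow_single,
      root_label_rootNeg, hlabel, root_negEdge, hw]
    push_cast
    simp
  obtain ⟨x, hx⟩ := hg
  intro h
  have h0 := LinearMap.congr_fun h x
  rw [LinearMap.comp_apply, hx, LinearMap.zero_apply, loopGap_apply,
    Finset.sum_eq_single_of_mem 0 (by simp)] at h0
  · have e1 : (⟨v, .inr (.inl 0)⟩ : EdgeIndex n) = rootNeg v := rfl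
    have e2 : (rootNeg v : EdgeIndex n) ≠ rootNeg w := fun h => hwv (congrArg Sigma.fst h).symm
    have e3 : (rootNeg v : EdgeIndex n) ≠ ⟨v, .inr (.inl l)⟩ := by
      intro h
      exact hl0 (congrArg Fin.val ((neg_eq_rootNeg_iff v v l).1 h.symm).2)
    rw [e1] at h0
    simp [g, e2, e3, loop_ne_rootNeg] at h0
  · intro j hj hj0
    have hjl : j ≠ l := ((Finset.mem_Iic.1 hj).trans_lt hil).ne
    have e1 : ∀ w', (⟨v, .inr (.inl j)⟩ : EdgeIndex n) ≠ rootNeg w' := fun w' h =>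
      hj0 ((neg_eq_rootNeg_iff v w' j).1 h).2
    simp [g, e1, hjl]

theorem aedisjoint_flowPiece [NeZero n] :
    Pairwise (Function.onFun (AEDisjoint volume) (flowPiece (n := n))) := by
  have key : ∀ (k l : (v : Fin n) → Fin (v + 1)) (v : Fin n), k v < l v →
      volume (flowPiece k ∩ flowPiece l) = 0 := by
    intro k l v hv
    refine measure_mono_null ?_ (volume_levelSet_eq_zero ((loopGap v (k v)).comp flowParam)
      (loopGap_comp_flowParam_ne_zero v (k v) (l v) hv) (-loopGap v (k v) baseFlow))
    rintro x ⟨hk, hl⟩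
    obtain ⟨hpos, hk⟩ := (flowChange_symm_nonneg_iff _ _).1 hk
    obtain ⟨-, hl⟩ := (flowChange_symm_nonneg_iff _ _).1 hl
    have hmono : ∑ j ∈ Finset.Iic (k v), (flowParam x + baseFlow : EdgeIndex n → ℝ)
          ⟨v, .inr (.inl j)⟩
        ≤ ∑ j ∈ Finset.Iio (l v), (flowParam x + baseFlow : EdgeIndex n → ℝ)
          ⟨v, .inr (.inl j)⟩ :=
      Finset.sum_le_sum_of_subset_of_nonneg
        (fun j hj => Finset.mem_Iio.2 ((Finset.mem_Iic.1 hj).trans_lt hv)) fun _ _ _ => hpos _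
    -- The loop value is at most the sum up to `k v`, which is at most the sum below `l v`, which is
    -- at most the loop value; equality holds throughout.
    have hzero : loopGap v (k v) (flowParam x + baseFlow) = 0 := by
      rw [loopGap_apply]
      linarith [(hk v).2, (hl v).1]
    rw [map_add] at hzero
    exact eq_neg_of_add_eq_zero_left hzero
  intro k l hkl
  obtain ⟨v, hv⟩ := Function.ne_iff.1 hkl
  rcases lt_or_gt_of_ne hv with h | h
  · exact key k l v h
  · show volume (flowPiece k ∩ flowPiece l) = 0
    rw [Set.inter_comm]
    exact key l k v h

theorem measurableSet_flowPiece [NeZero n] (k : (v : Fin n) → Fin (v + 1)) :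
    MeasurableSet (flowPiece k) := by
  have h1 := (flowChange k).symm.toLinearMap.continuous_of_finiteDimensional
  have h2 := h1.comp (continuous_flowParam_add (baseFlow (n := n)))
  refine IsClosed.measurableSet ?_
  simp only [flowPiece, Set.ofPred_forall]
  exact isClosed_iInter fun e => isClosed_le continuous_const ((continuous_apply e).comp h2)

theorem volume_flowRegion_ne_top [NeZero n] : volume (flowRegion n) ≠ ⊤ := by
  have hbox : volume (Set.Icc (0 : Free n → ℝ) fun _ => (n + 1 : ℝ) * 2) ≠ ⊤ :=
    isCompact_Icc.measure_lt_top.ne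
  refine measure_ne_top_of_subset ?_ hbox
  intro x hx
  have hflow := netflow_flowParam_add_baseFlow x 1
  rw [one_smul, mul_one] at hflow
  have hx' : ∀ e, 0 ≤ (flowParam x + baseFlow : EdgeIndex n → ℝ) e := hx
  have hval : ∀ e : Free n, (flowParam x + baseFlow : EdgeIndex n → ℝ) e = x e := fun e => by
    rw [Pi.add_apply, flowParam_apply_free, baseFlow_free, add_zero]
  refine ⟨fun e => ?_, fun e => ?_⟩
  · rw [← hval]
    exact hx' e
  · rw [← hval]
    exact le_of_netflow_eq hx' hflow e

theorem volume_flowRegion [NeZero n] :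
    volume.real (flowRegion n) = ∑ k, volume.real (flowPiece (n := n) k) := by
  have hle : ∀ k, flowPiece k ⊆ flowRegion n := fun k => by
    rw [flowRegion_eq_iUnion]
    exact Set.subset_iUnion _ k
  rw [Measure.real, flowRegion_eq_iUnion, measure_iUnion₀ aedisjoint_flowPiece
    fun k => (measurableSet_flowPiece k).nullMeasurableSet, tsum_fintype, ENNReal.toReal_sum]
  · rfl
  · exact fun k _ => measure_ne_top_of_subset (hle k) volume_flowRegion_ne_top

end EdgeIndex

theorem theorem1 (n : ℕ) (hn : 1 ≤ n) :
    normalizedVolume (CRYC n) =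
      ∑ G ∈ graphFamily n, normalizedVolume (G.flowPolytope (netflowTwo n)) := by
  have : NeZero n := ⟨by omega⟩
  rw [graphFamily, Finset.sum_image EdgeIndex.familySum_injective.injOn,
    EdgeIndex.normalizedVolume_CRYC, EdgeIndex.volume_flowRegion, Finset.mul_sum]
  exact Finset.sum_congr rfl fun k _ => (EdgeIndex.normalizedVolume_family k).symm
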